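/- A function $g:\mathbb R\to\mathbb R$ is called unimodal if it is quasi-concave, i.e. $g(\mu x+(1-\mu)y)\ge\min\{g(x),g(y)\}$ for all $x,y\in\mathbb R$ and $\mu\in[0,1]$. An LTI system with impulse response $g:\mathbb R\to\mathbb R$ is called strongly unimodal if, for every unimodal input $u$ for which the convolution $(g*u)(t)=\int_{-\infty}^{\infty}g(t-\tau)u(\tau)\,d\tau$ exists (converges absolutely) for all $t\in\mathbb R$, the output $g*u$ is again unimodal. A triple $(A,b,c)$ with $A\in\mathbb R^{n\times n}$ and $b,c^{\mathsf T}\in\mathbb R^n$ is a realization of $g$ if $g(t)=c\,e^{At}b$ for $t\ge 0$ and $g(t)=0$ for $t<0$; it is minimal if no realization of $g$ has smaller dimension. Let $\lambda_1(A),\dots,\lambda_n(A)\in\mathbb C$ be the eigenvalues of $A$, counted with algebraic multiplicity and ordered by descending real part, eigenvalues with equal real parts being ordered by ascending modulus, and those with also equal moduli by ascending imaginary part. **Theorem.** Let $(A,b,c)$ be a minimal realization of the impulse response of a strongly unimodal LTI system. Then its two dominant poles are real: $\lambda_1(A)\in\mathbb R$ and $\lambda_2(A)\in\mathbb R$ (whenever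 these exist, i.e. $n\ge 1$, respectively $n\ge 2$). In particular, if $n=3$, then all three poles $\lambda_1(A),\lambda_2(A),\lambda_3(A)$ are real. -/

import Mathlib

open MeasureTheory
open scoped Matrix

namespace UnimodalLTI

/-- A real function on the line is unimodal if it is quasi-concave:
`min (g x) (g y) ≤ g (a x + (1 - a) y)` for all `x`, `y` and `a ∈ [0, 1]`. -/
def IsUnimodal (g : ℝ → ℝ) : Prop :=
  QuasiconcaveOn ℝ Set.univ g

/-- The convolution `(g ∗ u)(t) = ∫ g(τ) u(t - τ) dτ = ∫ g(t - τ) u(τ) dτ`. -/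
noncomputable def conv (g u : ℝ → ℝ) : ℝ → ℝ :=
  convolution g u (ContinuousLinearMap.mul ℝ ℝ) volume

/-- The integral that defines `g ∗ u` converges absolutely at every time. -/
def ConvExists (g u : ℝ → ℝ) : Prop :=
  ConvolutionExists g u (ContinuousLinearMap.mul ℝ ℝ) volume

/-- The LTI system with impulse response `g` is strongly unimodal: it maps every unimodal input
(for which the output is defined) to a unimodal output. -/
def IsStronglyUnimodal (g : ℝ → ℝ) : Prop :=
  ∀ u : ℝ → ℝ, IsUnimodal u → ConvExists g u → IsUnimodal (conv g u)

/-- The impulse response `g(t) = c exp(A t) b` for `t ≥ 0`, `g(t) = 0` for `t < 0`, of the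
state-space model `x' = A x + b u`, `y = c x`. -/
noncomputable def impulseResponse {n : ℕ} (A : Matrix (Fin n) (Fin n) ℝ) (b c : Fin n → ℝ) :
    ℝ → ℝ :=
  (Set.Ici (0 : ℝ)).indicator fun t => c ⬝ᵥ (NormedSpace.exp (t • A) *ᵥ b)

/-- `(A, b, c)` is a realization of the impulse response `g`. -/
def IsRealization {n : ℕ} (A : Matrix (Fin n) (Fin n) ℝ) (b c : Fin n → ℝ) (g : ℝ → ℝ) : Prop :=
  impulseResponse A b c = g

/-- `(A, b, c)` is a realization of `g` of the least possible state dimension. -/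
def IsMinimalRealization {n : ℕ} (A : Matrix (Fin n) (Fin n) ℝ) (b c : Fin n → ℝ)
    (g : ℝ → ℝ) : Prop :=
  IsRealization A b c g ∧
    ∀ (m : ℕ) (A' : Matrix (Fin m) (Fin m) ℝ) (b' c' : Fin m → ℝ),
      IsRealization A' b' c' g → n ≤ m

/-- The order in which eigenvalues are listed: by descending real part; for equal real parts by
ascending modulus; for equal real parts and moduli (conjugates) by ascending imaginary part. -/
def Precedes (z w : ℂ) : Prop :=
  w.re < z.re ∨ (z.re = w.re ∧ (‖z‖ < ‖w‖ ∨ (‖z‖ = ‖w‖ ∧ z.im ≤ w.im)))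

noncomputable instance : DecidableRel Precedes := fun _ _ => Classical.propDecidable _

instance : IsTrans ℂ Precedes where
  trans x y z hxy hyz := by
    unfold Precedes at *
    grind

instance : Std.Antisymm Precedes where
  antisymm x y hxy hyx := by
    unfold Precedes at *
    apply Complex.ext <;> grind

instance : Std.Total Precedes where
  total x y := by
    unfold Precedes
    grind

/-- The complex eigenvalues of the real matrix `A`, with algebraic multiplicity, in order. -/
noncomputable def eigenvalueList {n : ℕ} (A : Matrix (Fin n) (Fin n) ℝ) : List ℂ :=
  ((A.map (algebraMap ℝ ℂ)).charpoly.roots).sort Precedes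

theorem length_eigenvalueList {n : ℕ} (A : Matrix (Fin n) (Fin n) ℝ) :
    (eigenvalueList A).length = n := by
  unfold eigenvalueList
  rw [Multiset.length_sort, ← (IsAlgClosed.splits _).natDegree_eq_card_roots,
    Matrix.charpoly_natDegree_eq_dim, Fintype.card_fin]

/-- `eigenvalue A 0 = λ₁(A)`, `eigenvalue A 1 = λ₂(A)`, ..., `eigenvalue A (n - 1) = λₙ(A)`. -/
noncomputable def eigenvalue {n : ℕ} (A : Matrix (Fin n) (Fin n) ℝ) (i : Fin n) : ℂ :=
  (eigenvalueList A).get (i.cast (length_eigenvalueList A).symm)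

end UnimodalLTI

/-! The output for an input with a jump `a` at time 0 and a jump `-b` at time `s` has derivative `a
g(t) - b g(t - s)`, which unimodality forbids to turn from negative to positive. Suitable choices of
`a`, `b`, `s` show that `g` is nonnegative and log-concave on the positive half-line.

By Cayley–Hamilton the Laplace transform of `g` is rational with poles among the eigenvalues, and
minimality means that no factor of the characteristic polynomial cancels. For a nonnegative function
`|L(x + iy)| ≤ L(x)`, so a pole on the critical line forces a pole at its real point
(`AnnihilatedBy.eq_zero_of_nonneg`). A nonreal `λ₁` contradicts this, because the ordering would
have listed the real point first.

Let `ρ = λ₁`. If `ρ` is a multiple root, then `λ₂ = ρ`. Otherwise log-concavity makes `exp(-ρt)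
g(t)` nondecreasing, since a single decrease would propagate to geometric decay and remove the pole
at `ρ`. Hence `g(t)` lies below its dominant mode `a exp(ρt)`, and the difference `a exp(ρt) - g(t)`
is nonnegative, with `λ₂` as its dominant pole. The same argument applied to it shows that `λ₂` is
real (`AnnihilatedBy.eq_zero_of_logConcave`). For `n = 3` the trace takes care of `λ₃`. -/

namespace UnimodalLTI

/-! ### Laplace transforms of exponential polynomials and the Pringsheim–Landau argument -/

section LaplaceTransform

open Polynomial Filter Topology Set

variable {E : Type*} [AddCommGroup E] [Module ℂ E] {T : Module.End ℂ E} {φ : E →ₗ[ℂ] (ℝ → ℂ)}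

/-- The Laplace transform of a function on the positive half-line. -/
noncomputable def laplace (f : ℝ → ℂ) (z : ℂ) : ℂ :=
  ∫ t in Ioi (0 : ℝ), Complex.exp (-z * t) * f t

theorem hasDerivAt_exp_neg_mul (z : ℂ) (t : ℝ) :
    HasDerivAt (fun t : ℝ => Complex.exp (-z * t)) (Complex.exp (-z * t) * -z) t := by
  have h : HasDerivAt (fun t : ℝ => -z * (t : ℂ)) (-z * 1) t :=
    (Complex.ofRealCLM.hasDerivAt (x := t)).const_mul (-z)
  simpa using h.cexp

theorem norm_exp_neg_mul (z : ℂ) (t : ℝ) : ‖Complex.exp (-z * t)‖ = Real.exp (-z.re * t) := by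
  simp [Complex.norm_exp]

/-- Functions annihilated by a constant-coefficient differential operator grow at most
exponentially, with any rate beyond the real parts of its roots. -/
theorem exists_norm_le_exp (hφ : ∀ v t, HasDerivAt (φ v) (φ (T v) t) t) {α β : ℝ} (hβ : α < β) :
    ∀ (d : ℕ) (P : ℂ[X]) (v : E), P.natDegree = d → P ≠ 0 → aeval T P v = 0 →
      (∀ z, P.IsRoot z → z.re ≤ α) → ∃ C, 0 ≤ C ∧ ∀ t : ℝ, 0 ≤ t → ‖φ v t‖ ≤ C * Real.exp (β * t) := by
  intro d
  induction d with
  | zero =>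
    intro P v hd hP hv _
    obtain ⟨a, rfl⟩ := natDegree_eq_zero.1 hd
    have ha : a ≠ 0 := by rintro rfl; simp at hP
    have hv0 : v = 0 := by
      simpa [Module.algebraMap_end_apply, ha] using hv
    exact ⟨0, le_rfl, by simp [hv0]⟩
  | succ d ih =>
    intro P v hd hP hv hroots
    obtain ⟨l, hl⟩ := IsAlgClosed.exists_root P (by
      rw [degree_eq_natDegree hP, hd]; exact_mod_cast Nat.succ_ne_zero d)
    obtain ⟨Q, rfl⟩ := dvd_iff_isRoot.2 hl
    have hQ : Q ≠ 0 := right_ne_zero_of_mul hP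
    rw [natDegree_mul (X_sub_C_ne_zero l) hQ, natDegree_X_sub_C] at hd
    obtain ⟨C, hC, hb⟩ := ih Q (T v - l • v) (by omega) hQ (by
      rw [mul_comm] at hv
      simpa [Module.algebraMap_end_apply] using hv) (fun z hz => hroots z (by
        rw [IsRoot.def] at hz ⊢
        simp [hz]))
    -- Removing the factor `e^{lt}` leaves a function whose derivative is at most `C e^{δt}`. Since
    -- `β` lies strictly beyond all roots, `δ > 0` and integration loses only a constant; this
    -- absorbs the powers of `t` from multiple roots.
    set δ := β - l.re with hδ
    have hδ0 : 0 < δ := by have := hroots l hl; linarith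
    have hψ : ∀ t : ℝ, HasDerivAt (fun t : ℝ => Complex.exp (-l * t) * φ v t)
        (Complex.exp (-l * t) * φ (T v - l • v) t) t := by
      intro t
      refine ((hasDerivAt_exp_neg_mul l t).mul (hφ v t)).congr_deriv ?_
      simp
      ring
    have hB : ∀ t : ℝ, HasDerivAt (fun t : ℝ => ‖φ v 0‖ + C / δ * Real.exp (δ * t))
        (C * Real.exp (δ * t)) t := by
      intro t
      have h : HasDerivAt (fun t : ℝ => δ * t) (δ * 1) t := (hasDerivAt_id t).const_mul δ
      refine ((h.exp.const_mul (C / δ)).const_add ‖φ v 0‖).congr_deriv ?_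
      field_simp
    have hbound : ∀ t : ℝ, 0 ≤ t → ‖Complex.exp (-l * t) * φ v t‖ ≤
        ‖φ v 0‖ + C / δ * Real.exp (δ * t) := by
      intro t ht
      refine image_norm_le_of_norm_deriv_right_le_deriv_boundary (a := 0) (b := t)
        (fun x _ => (hψ x).continuousAt.continuousWithinAt)
        (fun x _ => (hψ x).hasDerivWithinAt) ?_ hB ?_ ⟨ht, le_rfl⟩
      · simp
        positivity
      · intro x hx
        rw [norm_mul, norm_exp_neg_mul]
        calc _ ≤ Real.exp (-l.re * x) * (C * Real.exp (β * x)) := by gcongr; exact hb x hx.1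
          _ = C * Real.exp (δ * x) := by
            rw [mul_left_comm, ← Real.exp_add, hδ]; ring_nf
    refine ⟨‖φ v 0‖ + C / δ, by positivity, fun t ht => ?_⟩
    have h := hbound t ht
    rw [norm_mul, norm_exp_neg_mul] at h
    have h1 : 1 ≤ Real.exp (δ * t) := Real.one_le_exp (by positivity)
    calc ‖φ v t‖ = Real.exp (l.re * t) * (Real.exp (-l.re * t) * ‖φ v t‖) := by
          rw [← mul_assoc, ← Real.exp_add]; simp
      _ ≤ Real.exp (l.re * t) * ((‖φ v 0‖ + C / δ) * Real.exp (δ * t)) := by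
          refine mul_le_mul_of_nonneg_left (h.trans ?_) (Real.exp_pos _).le
          nlinarith [norm_nonneg (φ v 0)]
      _ = _ := by
          rw [mul_left_comm, ← Real.exp_add, hδ]; ring_nf

/-- `v` is annihilated by a nonzero polynomial in `T` with all roots in `re z ≤ α`. -/
structure AnnihilatedBy (T : Module.End ℂ E) (P : ℂ[X]) (α : ℝ) (v : E) : Prop where
  ne_zero : P ≠ 0
  aeval_eq : aeval T P v = 0
  re_le : ∀ z, P.IsRoot z → z.re ≤ α

theorem AnnihilatedBy.aeval {P : ℂ[X]} {α : ℝ} {v : E} (h : AnnihilatedBy T P α v) (R : ℂ[X]) :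
    AnnihilatedBy T P α (aeval T R v) := by
  refine ⟨h.ne_zero, ?_, h.re_le⟩
  rw [← Module.End.mul_apply, ← map_mul, mul_comm, map_mul, Module.End.mul_apply, h.aeval_eq,
    map_zero]

section

variable {P : ℂ[X]} {α : ℝ} {v : E}

theorem AnnihilatedBy.exists_norm_le (h : AnnihilatedBy T P α v)
    (hφ : ∀ v t, HasDerivAt (φ v) (φ (T v) t) t) {z : ℂ} (hz : α < z.re) :
    ∃ C δ : ℝ, 0 < δ ∧ ∀ t : ℝ, 0 ≤ t → ‖Complex.exp (-z * t) * φ v t‖ ≤ C * Real.exp (-δ * t) := by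
  obtain ⟨C, -, hb⟩ := exists_norm_le_exp hφ (β := (α + z.re) / 2) (by linarith) _ P v rfl
    h.ne_zero h.aeval_eq h.re_le
  refine ⟨C, (z.re - α) / 2, by linarith, fun t ht => ?_⟩
  rw [norm_mul, norm_exp_neg_mul]
  calc _ ≤ Real.exp (-z.re * t) * (C * Real.exp ((α + z.re) / 2 * t)) := by gcongr; exact hb t ht
    _ = _ := by rw [mul_left_comm, ← Real.exp_add]; ring_nf

theorem AnnihilatedBy.integrableOn (h : AnnihilatedBy T P α v)
    (hφ : ∀ v t, HasDerivAt (φ v) (φ (T v) t) t) {z : ℂ} (hz : α < z.re) :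
    IntegrableOn (fun t : ℝ => Complex.exp (-z * t) * φ v t) (Ioi 0) := by
  obtain ⟨C, δ, hδ, hb⟩ := h.exists_norm_le hφ hz
  refine Integrable.mono' ((exp_neg_integrableOn_Ioi 0 hδ).const_mul C) ?_ ?_
  · have hc : Continuous (φ v) := continuous_iff_continuousAt.2 fun t => (hφ v t).continuousAt
    exact Continuous.aestronglyMeasurable (by fun_prop)
  · exact (ae_restrict_mem measurableSet_Ioi).mono fun t ht => hb t (le_of_lt ht)

theorem AnnihilatedBy.tendsto_zero (h : AnnihilatedBy T P α v)
    (hφ : ∀ v t, HasDerivAt (φ v) (φ (T v) t) t) {z : ℂ} (hz : α < z.re) :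
    Tendsto (fun t : ℝ => Complex.exp (-z * t) * φ v t) atTop (𝓝 0) := by
  obtain ⟨C, δ, hδ, hb⟩ := h.exists_norm_le hφ hz
  refine squeeze_zero_norm' ((eventually_ge_atTop 0).mono hb) ?_
  have : Tendsto (fun t : ℝ => Real.exp (-δ * t)) atTop (𝓝 0) :=
    Real.tendsto_exp_atBot.comp (tendsto_id.const_mul_atTop_of_neg (by linarith))
  simpa using this.const_mul C

theorem AnnihilatedBy.laplace_map (h : AnnihilatedBy T P α v)
    (hφ : ∀ v t, HasDerivAt (φ v) (φ (T v) t) t) {z : ℂ} (hz : α < z.re) :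
    laplace (φ (T v)) z = z * laplace (φ v) z - φ v 0 := by
  have hT : AnnihilatedBy T P α (T v) := by simpa using h.aeval X
  have i1 := h.integrableOn hφ hz
  have i2 := hT.integrableOn hφ hz
  have hd : ∀ t : ℝ, HasDerivAt (fun t : ℝ => Complex.exp (-z * t) * φ v t)
      (Complex.exp (-z * t) * φ (T v) t - z * (Complex.exp (-z * t) * φ v t)) t := by
    intro t
    refine ((hasDerivAt_exp_neg_mul z t).mul (hφ v t)).congr_deriv ?_
    ring
  have key := integral_Ioi_of_hasDerivAt_of_tendsto (a := 0) (hd 0).continuousAt.continuousWithinAt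
    (fun t _ => hd t) (i2.sub (i1.const_mul z)) (h.tendsto_zero hφ hz)
  rw [integral_sub i2 (i1.const_mul z), integral_const_mul] at key
  simp only [laplace]
  simp at key ⊢
  linear_combination key

/-- Iterates `L(f') = z L(f) - f(0)`, with `M` collecting the initial values. For `R = P` the left
side vanishes, so `L = M / P`: a continuation past the line of convergence for which continuity of
`M` suffices. -/
theorem AnnihilatedBy.exists_laplace_aeval (h : AnnihilatedBy T P α v)
    (hφ : ∀ v t, HasDerivAt (φ v) (φ (T v) t) t) (R : ℂ[X]) :
    ∃ M : ℂ → ℂ, Continuous M ∧ ∀ z : ℂ, α < z.re →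
      laplace (φ (Polynomial.aeval T R v)) z = R.eval z * laplace (φ v) z - M z := by
  induction R using Polynomial.induction_on with
  | C a =>
    refine ⟨0, continuous_zero, fun z hz => ?_⟩
    simp [Module.algebraMap_end_apply, laplace, mul_left_comm _ a, integral_const_mul]
  | add p q hp hq =>
    obtain ⟨M, hM, hp⟩ := hp
    obtain ⟨N, hN, hq⟩ := hq
    refine ⟨fun z => M z + N z, hM.add hN, fun z hz => ?_⟩
    have i1 := (h.aeval p).integrableOn hφ hz
    have i2 := (h.aeval q).integrableOn hφ hz
    have : laplace (φ (Polynomial.aeval T (p + q) v)) z =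
        laplace (φ (Polynomial.aeval T p v)) z + laplace (φ (Polynomial.aeval T q v)) z := by
      simp only [laplace]
      rw [← integral_add i1 i2]
      simp [mul_add]
    rw [this, hp z hz, hq z hz, eval_add]
    ring
  | monomial k a ih =>
    obtain ⟨M, hM, ih⟩ := ih
    refine ⟨fun z => z * M z + φ (Polynomial.aeval T (C a * X ^ k) v) 0, by fun_prop,
      fun z hz => ?_⟩
    have e : Polynomial.aeval T (C a * X ^ (k + 1)) v = T (Polynomial.aeval T (C a * X ^ k) v) := by
      rw [show C a * X ^ (k + 1) = X * (C a * X ^ k) by ring, map_mul, aeval_X,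
        Module.End.mul_apply]
    rw [e, (h.aeval _).laplace_map hφ hz, ih z hz]
    simp only [eval_mul, eval_C, eval_pow, eval_X]
    ring

/-- The Laplace transform is bounded near points of the critical line that are not poles. -/
theorem AnnihilatedBy.laplace_bounded (h : AnnihilatedBy T P α v)
    (hφ : ∀ v t, HasDerivAt (φ v) (φ (T v) t) t) {z : ℂ} (hz : α ≤ z.re) (hPz : P.eval z ≠ 0) :
    ∃ K, ∀ᶠ σ : ℝ in 𝓝[>] 0, ‖laplace (φ v) (z + σ)‖ ≤ K := by
  obtain ⟨M, hM, hl⟩ := h.exists_laplace_aeval hφ P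
  have hc : ContinuousAt (fun σ : ℝ => ‖M (z + σ) / P.eval (z + σ)‖) 0 := by
    refine ContinuousAt.norm (ContinuousAt.div (by fun_prop) ?_ (by simpa using hPz))
    exact (P.continuous.comp (by fun_prop : Continuous fun σ : ℝ => z + (σ : ℂ))).continuousAt
  have hne : ∀ᶠ σ : ℝ in 𝓝 0, P.eval (z + σ) ≠ 0 := by
    have : ContinuousAt (fun σ : ℝ => P.eval (z + σ)) 0 :=
      (P.continuous.comp (by fun_prop : Continuous fun σ : ℝ => z + (σ : ℂ))).continuousAt
    exact this.eventually_ne (by simpa using hPz)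
  refine ⟨‖M (z + (0 : ℝ)) / P.eval (z + (0 : ℝ))‖ + 1, ?_⟩
  filter_upwards [nhdsWithin_le_nhds (hc.eventually (gt_mem_nhds (lt_add_one _))),
    nhdsWithin_le_nhds hne, self_mem_nhdsWithin] with σ h1 h2 h3
  have h3 : 0 < σ := h3
  have := hl (z + σ) (by simp; linarith)
  rw [h.aeval_eq] at this
  have e : laplace (φ v) (z + σ) = M (z + σ) / P.eval (z + σ) := by
    rw [eq_div_iff h2]
    simp [laplace] at this ⊢
    linear_combination -this
  rw [e]
  exact h1.le

theorem eq_zero_of_map_eq_smul (hφ : ∀ v t, HasDerivAt (φ v) (φ (T v) t) t) {w : E} {l : ℂ}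
    (hw : T w = l • w) (t : ℝ) : φ w t = φ w 0 * Complex.exp (l * t) := by
  have hd : ∀ t : ℝ, HasDerivAt (fun t : ℝ => Complex.exp (-l * t) * φ w t) 0 t := by
    intro t
    refine ((hasDerivAt_exp_neg_mul l t).mul (hφ w t)).congr_deriv ?_
    simp [hw]
    ring
  have := is_const_of_deriv_eq_zero (fun t => (hd t).differentiableAt) (fun t => (hd t).deriv) t 0
  simp at this
  rw [← this, mul_right_comm, ← Complex.exp_add]
  simp

/-- A point of the critical line where the Laplace transform is bounded is not a pole. -/
theorem AnnihilatedBy.eq_zero_of_bounded {Q : ℂ[X]} {l : ℂ}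
    (h : AnnihilatedBy T ((X - C l) * Q) l.re v)
    (hφ : ∀ v t, HasDerivAt (φ v) (φ (T v) t) t)
    (hb : ∃ K, ∀ᶠ σ : ℝ in 𝓝[>] 0, ‖laplace (φ v) (l + σ)‖ ≤ K) (t : ℝ) :
    φ (Polynomial.aeval T Q v) t = 0 := by
  obtain ⟨K, hK⟩ := hb
  obtain ⟨M, hM, hl⟩ := h.exists_laplace_aeval hφ Q
  -- `Q(T)v` is an eigenvector for `l`, even when `Q` also vanishes at `l`, so its response is `κ
  -- e^{lt}` with transform `κ / (z - l)`. Thus `σ` times this transform at `l + σ` is constantly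
  -- `κ`, whereas boundedness of `L` makes it tend to 0.
  have hw : T (Polynomial.aeval T Q v) = l • Polynomial.aeval T Q v := by
    have := h.aeval_eq
    simpa [sub_eq_zero, Module.algebraMap_end_apply] using this
  rw [eq_zero_of_map_eq_smul hφ hw]
  suffices h0 : φ (Polynomial.aeval T Q v) 0 = 0 by simp [h0]
  have hlim : Tendsto (fun σ : ℝ => (σ : ℂ) * (Q.eval (l + σ) * laplace (φ v) (l + σ) - M (l + σ)))
      (𝓝[>] 0) (𝓝 0) := by
    have c1 : Tendsto (fun σ : ℝ => (σ : ℂ) * Q.eval (l + σ)) (𝓝[>] 0) (𝓝 0) := by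
      have : Continuous (fun σ : ℝ => (σ : ℂ) * Q.eval (l + σ)) :=
        Complex.continuous_ofReal.mul (Q.continuous.comp (by fun_prop))
      simpa using (this.tendsto 0).mono_left nhdsWithin_le_nhds
    have c2 : Tendsto (fun σ : ℝ => (σ : ℂ) * M (l + σ)) (𝓝[>] 0) (𝓝 0) := by
      have : Continuous (fun σ : ℝ => (σ : ℂ) * M (l + σ)) := by fun_prop
      simpa using (this.tendsto 0).mono_left nhdsWithin_le_nhds
    have c3 := c1.zero_mul_isBoundedUnder_le (g := fun σ : ℝ => laplace (φ v) (l + σ))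
      (isBoundedUnder_of_eventually_le hK)
    simpa [mul_sub, mul_assoc] using c3.sub c2
  have hcst : Tendsto (fun σ : ℝ => (σ : ℂ) * (Q.eval (l + σ) * laplace (φ v) (l + σ) - M (l + σ)))
      (𝓝[>] 0) (𝓝 (φ (Polynomial.aeval T Q v) 0)) := by
    refine tendsto_const_nhds.congr' ?_
    filter_upwards [self_mem_nhdsWithin] with σ hσ
    have hσ' : l.re < (l + σ).re := by simpa using hσ
    rw [← hl _ hσ']
    have e := (h.aeval Q).laplace_map hφ hσ'
    rw [hw] at e
    have e2 : laplace (φ (l • Polynomial.aeval T Q v)) (l + σ) =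
        l * laplace (φ (Polynomial.aeval T Q v)) (l + σ) := by
      simp [laplace, mul_left_comm _ l, integral_const_mul]
    rw [e2] at e
    linear_combination e
  exact tendsto_nhds_unique hcst hlim

theorem laplace_ofReal {f : ℝ → ℂ} {u : ℝ → ℝ} (hf : ∀ t, 0 < t → f t = u t) (σ : ℝ) :
    laplace f σ = ((∫ t in Ioi (0 : ℝ), Real.exp (-σ * t) * u t : ℝ) : ℂ) := by
  rw [laplace, ← integral_complex_ofReal]
  refine setIntegral_congr_fun measurableSet_Ioi fun t ht => ?_
  simp [hf t ht]

theorem norm_laplace_le {f : ℝ → ℂ} {u : ℝ → ℝ} (hf : ∀ t, 0 < t → f t = u t)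
    (hu : ∀ t, 0 < t → 0 ≤ u t) (z : ℂ) : ‖laplace f z‖ ≤ ‖laplace f z.re‖ := by
  rw [laplace_ofReal hf, Complex.norm_real]
  refine (norm_integral_le_integral_norm _).trans (le_trans (le_of_eq ?_) (le_abs_self _))
  refine setIntegral_congr_fun measurableSet_Ioi fun t ht => ?_
  simp only [norm_mul, norm_exp_neg_mul]
  rw [hf t ht, Complex.norm_real, Real.norm_of_nonneg (hu t ht)]

/-- **Pringsheim–Landau**: a nonnegative function has no pole on the critical line unless the real
point of that line is a pole. -/
theorem AnnihilatedBy.eq_zero_of_nonneg {Q : ℂ[X]} {l : ℂ} {u : ℝ → ℝ}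
    (h : AnnihilatedBy T ((X - C l) * Q) l.re v)
    (hφ : ∀ v t, HasDerivAt (φ v) (φ (T v) t) t)
    (hf : ∀ t, 0 < t → φ v t = u t) (hu : ∀ t, 0 < t → 0 ≤ u t)
    (hre : ((X - C l) * Q).eval (l.re : ℂ) ≠ 0) (t : ℝ) :
    φ (Polynomial.aeval T Q v) t = 0 := by
  -- The bound at the real point passes to `l` because `|L(l + σ)| ≤ |L(re l + σ)|`.
  obtain ⟨K, hK⟩ := h.laplace_bounded hφ (z := l.re) (by simp) hre
  refine h.eq_zero_of_bounded hφ ⟨K, hK.mono fun σ hσ => ?_⟩ t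
  refine (norm_laplace_le hf hu _).trans ?_
  simpa using hσ

end

end LaplaceTransform

/-! ### Nonnegativity and log-concavity from step inputs -/

section StrongUnimodality

open Filter Topology Set

theorem isUnimodal_iff {g : ℝ → ℝ} :
    IsUnimodal g ↔ ∀ x y z, x ≤ y → y ≤ z → min (g x) (g z) ≤ g y := by
  unfold IsUnimodal QuasiconcaveOn
  constructor
  · intro h x y z hxy hyz
    have hc := (h (min (g x) (g z))).ordConnected
    exact (hc.out (x := x) (y := z) ⟨mem_univ _, min_le_left _ _⟩ ⟨mem_univ _, min_le_right _ _⟩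
      ⟨hxy, hyz⟩).2
  · intro h r
    refine OrdConnected.convex ⟨fun x hx z hz y hy => ⟨mem_univ _, ?_⟩⟩
    exact (le_min hx.2 hz.2).trans (h x y z hy.1 hy.2)

/-- A unimodal function does not increase once it has decreased. -/
theorem IsUnimodal.le_of_lt {g : ℝ → ℝ} (hg : IsUnimodal g) {x y z : ℝ} (hxy : x ≤ y)
    (hyz : y ≤ z) (h : g y < g x) : g z ≤ g y := by
  have := isUnimodal_iff.1 hg x y z hxy hyz
  by_contra! hc
  exact absurd this (not_le.2 (lt_min h hc))

/-- Just after `t₁` the function has dropped, so it can never increase again; a positive derivative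
at `t₂` would require lower values just before `t₂`. -/
theorem IsUnimodal.deriv_nonpos {y : ℝ → ℝ} (hy : IsUnimodal y) {t₁ t₂ d₁ d₂ : ℝ} (ht : t₁ < t₂)
    (h₁ : HasDerivAt y d₁ t₁) (h₂ : HasDerivAt y d₂ t₂) (hd : d₁ < 0) : d₂ ≤ 0 := by
  by_contra! hd₂
  have e₂ : ∀ᶠ w in 𝓝[<] t₂, y w < y t₂ := by
    have := (hasDerivAt_iff_tendsto_slope.1 h₂).eventually (lt_mem_nhds hd₂)
    filter_upwards [this.filter_mono (nhdsWithin_mono _ fun w (hw : w < t₂) => hw.ne),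
      self_mem_nhdsWithin] with w h hw
    have hw : w < t₂ := hw
    rw [slope_def_field] at h
    by_contra! hc
    exact absurd h (not_lt.2 (div_nonpos_of_nonneg_of_nonpos (by linarith) (by linarith)))
  have e₁ : ∀ᶠ w in 𝓝[>] t₁, y w < y t₁ := by
    have := (hasDerivAt_iff_tendsto_slope.1 h₁).eventually (gt_mem_nhds hd)
    filter_upwards [this.filter_mono (nhdsWithin_mono _ fun w (hw : t₁ < w) => hw.ne'),
      self_mem_nhdsWithin] with w h hw
    have hw : t₁ < w := hw
    rw [slope_def_field] at h
    by_contra! hc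
    exact absurd h (not_lt.2 (div_nonneg (by linarith) (by linarith)))
  obtain ⟨w, hw, hwt⟩ := (e₂.and (Ioo_mem_nhdsLT ht)).exists
  obtain ⟨x, hx, hxw⟩ := (e₁.and (Ioo_mem_nhdsGT hwt.1)).exists
  have hwx := hy.le_of_lt hxw.1.le hxw.2.le hx
  exact absurd hw (not_lt.2 (hy.le_of_lt hwt.1.le hwt.2.le (hwx.trans_lt hx)))

/-- The input that rises by `a` at time `0` and drops by `b` at time `s`. -/
noncomputable def twoStep (a b s : ℝ) (t : ℝ) : ℝ :=
  (if 0 ≤ t then a else 0) - if s ≤ t then b else 0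

theorem isUnimodal_twoStep {a b s : ℝ} (ha : 0 ≤ a) (hs : 0 ≤ s) :
    IsUnimodal (twoStep a b s) := by
  rw [isUnimodal_iff]
  intro x y z hxy hyz
  unfold twoStep
  rw [min_le_iff]
  split_ifs <;> first | (left; linarith) | (right; linarith)

variable {f : ℝ → ℝ}

theorem hasDerivAt_integral_Icc (hf : Continuous f) {t : ℝ} (ht : t ≠ 0) :
    HasDerivAt (fun t => ∫ x in Icc 0 t, f x) ((Ici 0).indicator f t) t := by
  rcases lt_or_gt_of_ne ht with h | h
  · rw [indicator_of_notMem (by simpa using h)]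
    refine (hasDerivAt_const t (0 : ℝ)).congr_of_eventuallyEq ?_
    filter_upwards [gt_mem_nhds h] with x hx
    simp [Icc_eq_empty (not_le.2 hx)]
  · rw [indicator_of_mem (by simpa using h.le)]
    refine (hf.integral_hasStrictDerivAt 0 t).hasDerivAt.congr_of_eventuallyEq ?_
    filter_upwards [lt_mem_nhds h] with x hx
    rw [intervalIntegral.integral_of_le hx.le, integral_Icc_eq_integral_Ioc]

theorem indicator_mul_twoStep (f : ℝ → ℝ) (a b s t τ : ℝ) :
    (Ici 0).indicator f τ * twoStep a b s (t - τ) =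
      a * (Icc 0 t).indicator f τ - b * (Icc 0 (t - s)).indicator f τ := by
  simp only [twoStep, indicator, mem_Ici, mem_Icc, sub_nonneg, le_sub_comm (a := s)]
  split_ifs <;> grind

theorem integrable_indicator_Icc (hf : Continuous f) (a b : ℝ) :
    Integrable ((Icc a b).indicator f) :=
  (hf.integrableOn_Icc).integrable_indicator measurableSet_Icc

theorem convExists_twoStep (hf : Continuous f) (a b s : ℝ) :
    ConvExists ((Ici 0).indicator f) (twoStep a b s) := by
  intro t
  have := ((integrable_indicator_Icc hf 0 t).const_mul a).sub
    ((integrable_indicator_Icc hf 0 (t - s)).const_mul b)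
  refine this.congr (ae_of_all _ fun τ => ?_)
  simp [indicator_mul_twoStep]

theorem conv_twoStep (hf : Continuous f) (a b s t : ℝ) :
    conv ((Ici 0).indicator f) (twoStep a b s) t =
      a * (∫ x in Icc 0 t, f x) - b * ∫ x in Icc 0 (t - s), f x := by
  simp only [conv, convolution, ContinuousLinearMap.mul_apply', indicator_mul_twoStep]
  rw [integral_sub ((integrable_indicator_Icc hf 0 t).const_mul a)
    ((integrable_indicator_Icc hf 0 (t - s)).const_mul b), integral_const_mul, integral_const_mul,
    integral_indicator measurableSet_Icc, integral_indicator measurableSet_Icc]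

/-- For a strongly unimodal system, `a g(t) - b g(t - s)` does not become positive after having
been negative. -/
theorem IsStronglyUnimodal.sub_nonpos (hg : IsStronglyUnimodal ((Ici 0).indicator f))
    (hf : Continuous f) {a b s t₁ t₂ : ℝ} (ha : 0 ≤ a) (hs : 0 ≤ s) (h1 : 0 < t₁)
    (h12 : t₁ < t₂) (hs1 : t₁ ≠ s) (hs2 : t₂ ≠ s)
    (h : a * (Ici 0).indicator f t₁ - b * (Ici 0).indicator f (t₁ - s) < 0) :
    a * (Ici 0).indicator f t₂ - b * (Ici 0).indicator f (t₂ - s) ≤ 0 := by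
  have hu := hg _ (isUnimodal_twoStep ha hs) (convExists_twoStep hf a b s)
  have hd : ∀ t, t ≠ 0 → t ≠ s → HasDerivAt (conv ((Ici 0).indicator f) (twoStep a b s))
      (a * (Ici 0).indicator f t - b * (Ici 0).indicator f (t - s)) t := by
    intro t h0 hts
    rw [show conv ((Ici 0).indicator f) (twoStep a b s) = _ from funext (conv_twoStep hf a b s)]
    exact ((hasDerivAt_integral_Icc hf h0).const_mul a).sub
      ((HasDerivAt.comp_sub_const t s (hasDerivAt_integral_Icc hf (sub_ne_zero.2 hts))).const_mul b)
  exact hu.deriv_nonpos h12 (hd _ h1.ne' hs1) (hd _ (h1.trans h12).ne' hs2) h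

theorem IsStronglyUnimodal.nonneg (hg : IsStronglyUnimodal ((Ici 0).indicator f))
    (hf : Continuous f) {t : ℝ} (ht : 0 < t) : 0 ≤ f t := by
  have hpos : ∀ t, 0 ≤ t → (Ici 0).indicator f t = f t := fun t h => indicator_of_mem h f
  have hneg : ∀ t, t < 0 → (Ici 0).indicator f t = 0 := fun t h =>
    indicator_of_notMem (by simpa using h) f
  by_contra! hc
  -- With the drop at `s = t + 1`, the output derivative at `t` is `a f(t) < 0`, and at `2t + 1` it
  -- is `a f(2t + 1) - f(t)`. Letting `a → 0` gives `f(t) ≥ 0`.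
  have key : ∀ a, 0 < a → 0 ≤ f t - a * f (t + 1 + t) := by
    intro a ha
    have := hg.sub_nonpos hf (a := a) (b := 1) (s := t + 1) (t₁ := t) (t₂ := t + 1 + t) ha.le
      (by linarith) ht (by linarith) (by linarith) (by linarith)
      (by rw [hpos t ht.le, hneg _ (by linarith)]; nlinarith)
    rw [hpos _ (by linarith), hpos _ (by linarith)] at this
    rw [show t + 1 + t - (t + 1) = t by ring] at this
    linarith
  have hlim : Tendsto (fun a : ℝ => f t - a * f (t + 1 + t)) (𝓝[>] 0) (𝓝 (f t)) := by
    have : Continuous fun a : ℝ => f t - a * f (t + 1 + t) := by fun_prop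
    simpa using (this.tendsto 0).mono_left nhdsWithin_le_nhds
  exact absurd (ge_of_tendsto hlim (eventually_mem_nhdsWithin.mono key)) (not_le.2 hc)

/-- The impulse response of a strongly unimodal system is log-concave. -/
theorem IsStronglyUnimodal.mul_le_mul (hg : IsStronglyUnimodal ((Ici 0).indicator f))
    (hf : Continuous f) {x s d : ℝ} (hx : 0 < x) (hs : 0 < s) (hd : 0 < d) :
    f x * f (x + s + d) ≤ f (x + s) * f (x + d) := by
  have hpos : ∀ t, 0 ≤ t → (Ici 0).indicator f t = f t := fun t h => indicator_of_mem h f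
  have h0 := hg.nonneg hf hx
  have h1 := hg.nonneg hf (show 0 < x + s by linarith)
  have h2 := hg.nonneg hf (show 0 < x + d by linarith)
  rcases h0.eq_or_lt with h0 | h0
  · rw [← h0]; simp; positivity
  -- For `a = f(x)` and `b = f(x + s)` the derivative at `x + s` would be exactly zero; `ε` makes it
  -- strictly negative.
  have key : ∀ ε, 0 < ε → f x * f (x + s + d) - (f (x + s) + ε) * f (x + d) ≤ 0 := by
    intro ε hε
    have := hg.sub_nonpos hf (a := f x) (b := f (x + s) + ε) (s := s) (t₁ := x + s)
      (t₂ := x + s + d) h0.le hs.le (by linarith) (by linarith) (by linarith)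
      (by linarith) (by
        rw [hpos _ (by linarith), hpos _ (by linarith), add_sub_cancel_right]
        nlinarith)
    rw [hpos _ (by linarith), hpos _ (by linarith)] at this
    rwa [show x + s + d - s = x + d by ring] at this
  have hlim : Tendsto (fun ε : ℝ => f x * f (x + s + d) - (f (x + s) + ε) * f (x + d)) (𝓝[>] 0)
      (𝓝 (f x * f (x + s + d) - f (x + s) * f (x + d))) := by
    have : Continuous fun ε : ℝ => f x * f (x + s + d) - (f (x + s) + ε) * f (x + d) := by fun_prop
    simpa using (this.tendsto 0).mono_left nhdsWithin_le_nhds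
  exact _root_.sub_nonpos.1 (le_of_tendsto hlim (eventually_mem_nhdsWithin.mono key))

end StrongUnimodality

/-! ### Comparison with the dominant mode -/

section SubdominantPole

open Polynomial Filter Topology Set

variable {E : Type*} [AddCommGroup E] [Module ℂ E] {T : Module.End ℂ E} {φ : E →ₗ[ℂ] (ℝ → ℂ)}
  {P Q S : ℂ[X]} {ρ : ℝ} {v : E} {u : ℝ → ℝ}

theorem AnnihilatedBy.integrableOn_real {α σ : ℝ} (h : AnnihilatedBy T P α v)
    (hφ : ∀ v t, HasDerivAt (φ v) (φ (T v) t) t) (hf : ∀ t, φ v t = u t) (hσ : α < σ) :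
    IntegrableOn (fun t : ℝ => Real.exp (-σ * t) * u t) (Ioi 0) := by
  have := (h.integrableOn hφ (z := σ) (by simpa using hσ)).re
  refine this.congr (ae_of_all _ fun t => ?_)
  have e : Complex.exp (-(σ : ℂ) * t) * (u t : ℂ) = ((Real.exp (-σ * t) * u t : ℝ) : ℂ) := by
    push_cast; rfl
  simp only [hf, e]
  exact Complex.ofReal_re _

theorem aeval_apply_of_map_eq_smul {w : E} {l : ℂ} (hw : T w = l • w) (R : ℂ[X]) :
    aeval T R w = R.eval l • w := by
  obtain ⟨R', hR⟩ := X_sub_C_dvd_sub_C_eval (a := l) (p := R)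
  have : aeval T (R - C (R.eval l)) w = 0 := by
    rw [hR, mul_comm, map_mul, Module.End.mul_apply]
    simp [hw, Module.algebraMap_end_apply]
  simpa [sub_eq_zero, Module.algebraMap_end_apply] using this

/-- If the normalized function shrinks by a factor `q < 1` over one step of length `s`,
log-concavity repeats this at all later times. The transform then stays bounded at `ρ`, which
contradicts `hne`. -/
theorem AnnihilatedBy.monotone_of_logConcave
    (h : AnnihilatedBy T ((X - C (ρ : ℂ)) * Q) ρ v)
    (hφ : ∀ v t, HasDerivAt (φ v) (φ (T v) t) t) (hf : ∀ t, φ v t = u t)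
    (hu : ∀ t, 0 < t → 0 ≤ u t)
    (hlog : ∀ x s d, 0 < x → 0 < s → 0 < d → u x * u (x + s + d) ≤ u (x + s) * u (x + d))
    (hne : ∃ t, φ (Polynomial.aeval T Q v) t ≠ 0) {x y : ℝ} (hx : 0 < x) (hxy : x < y) :
    Real.exp (-ρ * x) * u x ≤ Real.exp (-ρ * y) * u y := by
  obtain ⟨s, hs, rfl⟩ : ∃ s, 0 < s ∧ y = x + s := ⟨y - x, by linarith, by ring⟩
  by_contra! hc
  obtain ⟨t₀, ht₀⟩ := hne
  have hpos : 0 < u x := by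
    have h1 : 0 ≤ Real.exp (-ρ * (x + s)) * u (x + s) :=
      mul_nonneg (Real.exp_pos _).le (hu _ (by linarith))
    exact pos_of_mul_pos_right (h1.trans_lt hc) (Real.exp_pos _).le
  set q := Real.exp (-ρ * s) * (u (x + s) / u x) with hq
  have hq0 : 0 ≤ q := mul_nonneg (Real.exp_pos _).le (div_nonneg (hu _ (by linarith)) hpos.le)
  have hq1 : q < 1 := by
    rw [hq, ← mul_div_assoc, div_lt_one hpos]
    rw [show -ρ * (x + s) = -ρ * x + -ρ * s by ring, Real.exp_add, mul_assoc] at hc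
    exact lt_of_mul_lt_mul_left hc (Real.exp_pos _).le
  have hcu : Continuous u := by
    have hcφ : Continuous (φ v) := continuous_iff_continuousAt.2 fun t => (hφ v t).continuousAt
    have : u = fun t => (φ v t).re := by ext t; simp [hf]
    rw [this]
    exact Complex.continuous_re.comp hcφ
  -- The extra factor `e^{-σs} ≤ 1` is discarded, so that one `q` serves all `σ` and the bound is
  -- uniform as `σ → 0`.
  have hdecay : ∀ t, x < t → ∀ σ, 0 < σ →
      Real.exp (-(ρ + σ) * (t + s)) * u (t + s) ≤ q * (Real.exp (-(ρ + σ) * t) * u t) := by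
    intro t ht σ hσ
    have h1 := hlog x s (t - x) hx hs (by linarith)
    rw [show x + s + (t - x) = t + s by ring, show x + (t - x) = t by ring] at h1
    have h2 : u (t + s) ≤ u (x + s) / u x * u t := by
      rw [div_mul_eq_mul_div, le_div_iff₀ hpos]; linarith
    have h3 : Real.exp (-(ρ + σ) * (t + s)) ≤ Real.exp (-(ρ + σ) * t) * Real.exp (-ρ * s) := by
      rw [← Real.exp_add, Real.exp_le_exp]; nlinarith
    calc _ ≤ Real.exp (-(ρ + σ) * t) * Real.exp (-ρ * s) * (u (x + s) / u x * u t) :=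
          mul_le_mul h3 h2 (hu _ (by linarith)) (by positivity)
      _ = _ := by rw [hq]; ring
  have hl : ((ρ : ℂ)).re = ρ := by simp
  refine ht₀ (AnnihilatedBy.eq_zero_of_bounded (by rw [hl]; exact h) hφ
    ⟨(∫ t in Ioc 0 (x + s), Real.exp (-ρ * t) * u t) / (1 - q), ?_⟩ t₀)
  filter_upwards [self_mem_nhdsWithin] with σ hσ
  have hσ : 0 < σ := hσ
  rw [← Complex.ofReal_add, laplace_ofReal fun t _ => hf t, Complex.norm_real]
  have hi := h.integrableOn_real hφ hf (show ρ < ρ + σ by linarith)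
  have hk : ∀ t, 0 < t → 0 ≤ Real.exp (-(ρ + σ) * t) * u t := fun t ht =>
    mul_nonneg (Real.exp_pos _).le (hu t ht)
  set k := fun t => Real.exp (-(ρ + σ) * t) * u t with hkdef
  have hI0 : 0 ≤ ∫ t in Ioi (0 : ℝ), k t := setIntegral_nonneg measurableSet_Ioi hk
  rw [Real.norm_of_nonneg hI0, le_div_iff₀ (by linarith)]
  have hsub : Ioi (x + s) ⊆ Ioi (0 : ℝ) := Ioi_subset_Ioi (by linarith)
  have hsubx : Ioi x ⊆ Ioi (0 : ℝ) := Ioi_subset_Ioi hx.le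
  have hsplit : ∫ t in Ioi (0 : ℝ), k t =
      (∫ t in Ioc 0 (x + s), k t) + ∫ t in Ioi (x + s), k t := by
    rw [← setIntegral_union (Ioc_disjoint_Ioi le_rfl) measurableSet_Ioi
      (hi.mono_set Ioc_subset_Ioi_self) (hi.mono_set hsub), Ioc_union_Ioi_eq_Ioi (by linarith)]
  have hA : ∫ t in Ioc 0 (x + s), k t ≤ ∫ t in Ioc 0 (x + s), Real.exp (-ρ * t) * u t := by
    refine setIntegral_mono_on (hi.mono_set Ioc_subset_Ioi_self) ?_ measurableSet_Ioc
      fun t ht => ?_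
    · exact (Continuous.integrableOn_Icc (by fun_prop)).mono_set Ioc_subset_Icc_self
    · refine mul_le_mul_of_nonneg_right (Real.exp_le_exp.2 ?_) (hu t ht.1)
      nlinarith [ht.1]
  -- Shifting the tail by `s` gives `(1 - q) ∫ k ≤ ∫_0^{x+s} k`.
  have hB : ∫ t in Ioi (x + s), k t ≤ q * ∫ t in Ioi (0 : ℝ), k t := by
    have hpre : (fun t => t + s) ⁻¹' Ioi (x + s) = Ioi x := by simp
    have e : ∫ t in Ioi (x + s), k t = ∫ t in Ioi x, k (t + s) := by
      rw [← hpre]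
      exact ((measurePreserving_add_right volume s).setIntegral_preimage_emb
        (measurableEmbedding_addRight s) k _).symm
    have i1 : IntegrableOn (fun t => k (t + s)) (Ioi x) := by
      rw [← hpre]
      exact ((measurePreserving_add_right volume s).integrableOn_comp_preimage
        (measurableEmbedding_addRight s)).2 (hi.mono_set hsub)
    rw [e, ← integral_const_mul]
    calc _ ≤ ∫ t in Ioi x, q * k t :=
          setIntegral_mono_on i1 ((hi.mono_set hsubx).const_mul q) measurableSet_Ioi
            fun t ht => hdecay t ht σ hσ
      _ ≤ _ := by
          refine setIntegral_mono_set (hi.const_mul q) ?_ hsubx.eventuallyLE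
          exact (ae_restrict_mem measurableSet_Ioi).mono fun t ht => mul_nonneg hq0 (hk t ht)
  linarith

/-- A nonnegative log-concave function whose dominant pole `ρ` is simple is bounded above by its
dominant mode. -/
theorem AnnihilatedBy.exists_le_exp
    (h : AnnihilatedBy T ((X - C (ρ : ℂ)) * Q) ρ v)
    (hφ : ∀ v t, HasDerivAt (φ v) (φ (T v) t) t) (hf : ∀ t, φ v t = u t)
    (hu : ∀ t, 0 < t → 0 ≤ u t)
    (hlog : ∀ x s d, 0 < x → 0 < s → 0 < d → u x * u (x + s + d) ≤ u (x + s) * u (x + d))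
    (hne : ∃ t, φ (Polynomial.aeval T Q v) t ≠ 0) (hQ : Q.eval (ρ : ℂ) ≠ 0) :
    ∃ (w : E) (a : ℝ), T w = (ρ : ℂ) • w ∧ Polynomial.aeval T Q (w - v) = 0 ∧
      (∀ t : ℝ, φ w t = (a * Real.exp (ρ * t) : ℝ)) ∧
        ∀ t, 0 < t → u t ≤ a * Real.exp (ρ * t) := by
  have hQ0 : Q ≠ 0 := by rintro rfl; simp at hQ
  -- The component of `v` in the eigenspace of the simple root `ρ`; the rest of `v` is killed by
  -- `Q(T)`.
  set w := (Q.eval (ρ : ℂ))⁻¹ • Polynomial.aeval T Q v with hw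
  have hTw : T w = (ρ : ℂ) • w := by
    have := h.aeval_eq
    have e : T (Polynomial.aeval T Q v) = (ρ : ℂ) • Polynomial.aeval T Q v := by
      simpa [sub_eq_zero, Module.algebraMap_end_apply] using this
    rw [hw, map_smul, e, smul_comm]
  have hQw : Polynomial.aeval T Q (w - v) = 0 := by
    rw [map_sub, aeval_apply_of_map_eq_smul hTw, hw, smul_inv_smul₀ hQ, sub_self]
  have hw' : AnnihilatedBy T ((X - C (ρ : ℂ)) * Q) ρ w := by
    refine ⟨h.ne_zero, ?_, h.re_le⟩
    rw [aeval_apply_of_map_eq_smul hTw]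
    simp
  have hwv : AnnihilatedBy T Q ρ (w - v) := ⟨hQ0, hQw, fun z hz => h.re_le z (by
    rw [IsRoot.def] at hz ⊢; simp [hz])⟩
  obtain ⟨K, hK⟩ := hwv.laplace_bounded hφ (z := ρ) (by simp) hQ
  -- The amplitude of the mode is the residue at `ρ`: the transform of `w - v` is bounded there, so
  -- only `w` contributes to the limit.
  have hlimC : Tendsto (fun σ : ℝ => (σ : ℂ) * laplace (φ v) ((ρ : ℂ) + σ)) (𝓝[>] 0)
      (𝓝 (φ w 0)) := by
    have c0 : Tendsto (fun σ : ℝ => (σ : ℂ)) (𝓝[>] 0) (𝓝 0) := by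
      simpa using (Complex.continuous_ofReal.tendsto 0).mono_left nhdsWithin_le_nhds
    have c1 := c0.zero_mul_isBoundedUnder_le
      (g := fun σ : ℝ => laplace (φ (w - v)) ((ρ : ℂ) + σ)) (isBoundedUnder_of_eventually_le hK)
    have c2 := (tendsto_const_nhds (x := φ w 0)).sub c1
    rw [sub_zero] at c2
    refine c2.congr' ?_
    filter_upwards [self_mem_nhdsWithin] with σ hσ
    have hσ' : ρ < ((ρ : ℂ) + σ).re := by simpa using hσ
    have e1 := hw'.laplace_map hφ hσ'
    have e2 : laplace (φ (T w)) ((ρ : ℂ) + σ) = ρ * laplace (φ w) ((ρ : ℂ) + σ) := by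
      rw [hTw]
      simp [laplace, mul_left_comm _ (ρ : ℂ), integral_const_mul]
    have e3 : laplace (φ (w - v)) ((ρ : ℂ) + σ) =
        laplace (φ w) ((ρ : ℂ) + σ) - laplace (φ v) ((ρ : ℂ) + σ) := by
      simp only [laplace]
      rw [← integral_sub (hw'.integrableOn hφ hσ') (h.integrableOn hφ hσ')]
      simp [mul_sub]
    rw [e2] at e1
    rw [e3]
    linear_combination e1
  set J : ℝ → ℝ := fun σ => ∫ t in Ioi (0 : ℝ), Real.exp (-(ρ + σ) * t) * u t with hJ
  have hlim : Tendsto (fun σ : ℝ => ((σ * J σ : ℝ) : ℂ)) (𝓝[>] 0) (𝓝 (φ w 0)) := by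
    refine hlimC.congr fun σ => ?_
    rw [← Complex.ofReal_add, laplace_ofReal fun t _ => hf t]
    push_cast
    rfl
  have him : (φ w 0).im = 0 := by
    have := (Complex.continuous_im.tendsto _).comp hlim
    simp only [Function.comp_def, Complex.ofReal_im] at this
    exact (tendsto_nhds_unique this tendsto_const_nhds)
  have hre : Tendsto (fun σ : ℝ => σ * J σ) (𝓝[>] 0) (𝓝 (φ w 0).re) := by
    simpa only [Function.comp_def, Complex.ofReal_re] using
      (Complex.continuous_re.tendsto _).comp hlim
  refine ⟨w, (φ w 0).re, hTw, hQw, fun t => ?_, fun x hx => ?_⟩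
  · rw [eq_zero_of_map_eq_smul hφ hTw]
    nth_rewrite 1 [← Complex.re_add_im (φ w 0), him]
    push_cast
    simp
  · set m := Real.exp (-ρ * x) * u x with hm
    suffices hle : m ≤ (φ w 0).re by
      calc u x = m * Real.exp (ρ * x) := by
            rw [hm, mul_right_comm, ← Real.exp_add]; simp
        _ ≤ _ := by gcongr
    have hlow : Tendsto (fun σ : ℝ => m * Real.exp (-σ * x)) (𝓝[>] 0) (𝓝 m) := by
      have : Continuous fun σ : ℝ => m * Real.exp (-σ * x) := by fun_prop
      simpa using (this.tendsto 0).mono_left nhdsWithin_le_nhds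
    refine le_of_tendsto_of_tendsto hlow hre ?_
    filter_upwards [self_mem_nhdsWithin] with σ hσ
    have hσ : 0 < σ := hσ
    have hi := h.integrableOn_real hφ hf (show ρ < ρ + σ by linarith)
    have hsubx : Ioi x ⊆ Ioi (0 : ℝ) := Ioi_subset_Ioi hx.le
    -- By monotonicity `e^{-ρt} u(t) ≥ m` for `t > x`, whence `σ J(σ) ≥ m e^{-σx}`; as `σ → 0` the
    -- residue is at least `m`.
    have e : ∫ t in Ioi x, m * Real.exp (-σ * t) = m * (Real.exp (-σ * x) / σ) := by
      rw [integral_const_mul, integral_exp_mul_Ioi (by linarith)]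
      simp [neg_div_neg_eq]
    have hb : m * (Real.exp (-σ * x) / σ) ≤ J σ := by
      rw [← e]
      calc _ ≤ ∫ t in Ioi x, Real.exp (-(ρ + σ) * t) * u t := by
            refine setIntegral_mono_on ((exp_neg_integrableOn_Ioi x hσ).const_mul m)
              (hi.mono_set hsubx) measurableSet_Ioi fun t ht => ?_
            have := h.monotone_of_logConcave hφ hf hu hlog hne hx ht
            rw [show -(ρ + σ) * t = -ρ * t + -σ * t by ring, Real.exp_add,
              mul_right_comm (Real.exp (-ρ * t))]
            exact mul_le_mul_of_nonneg_right this (Real.exp_pos _).le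
        _ ≤ _ := by
            refine setIntegral_mono_set hi ?_ hsubx.eventuallyLE
            exact (ae_restrict_mem measurableSet_Ioi).mono fun t ht =>
              mul_nonneg (Real.exp_pos _).le (hu t ht)
    calc m * Real.exp (-σ * x) = σ * (m * (Real.exp (-σ * x) / σ)) := by field_simp
      _ ≤ _ := by gcongr

/-- The subdominant pole of a nonnegative log-concave function with a simple dominant pole is
real, or cancels. -/
theorem AnnihilatedBy.eq_zero_of_logConcave {l : ℂ}
    (h : AnnihilatedBy T ((X - C (ρ : ℂ)) * ((X - C l) * S)) ρ v)
    (hφ : ∀ v t, HasDerivAt (φ v) (φ (T v) t) t) (hf : ∀ t, φ v t = u t)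
    (hu : ∀ t, 0 < t → 0 ≤ u t)
    (hlog : ∀ x s d, 0 < x → 0 < s → 0 < d → u x * u (x + s + d) ≤ u (x + s) * u (x + d))
    (hne : ∃ t, φ (Polynomial.aeval T ((X - C l) * S) v) t ≠ 0)
    (hρ : ((X - C l) * S).eval (ρ : ℂ) ≠ 0) (hl : ∀ z, ((X - C l) * S).IsRoot z → z.re ≤ l.re)
    (hre : ((X - C l) * S).eval (l.re : ℂ) ≠ 0) (t : ℝ) :
    φ (Polynomial.aeval T ((X - C (ρ : ℂ)) * S) v) t = 0 := by
  obtain ⟨w, a, hTw, hQ, hwt, hle⟩ := h.exists_le_exp hφ hf hu hlog hne hρ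
  have hwv : AnnihilatedBy T ((X - C l) * S) l.re (w - v) :=
    ⟨right_ne_zero_of_mul h.ne_zero, hQ, hl⟩
  have h0 : ∀ t, φ (Polynomial.aeval T S (w - v)) t = 0 :=
    hwv.eq_zero_of_nonneg hφ (u := fun t => a * Real.exp (ρ * t) - u t)
      (fun t _ => by simp only [map_sub, Pi.sub_apply, hwt, hf]; push_cast; rfl)
      (fun t ht => sub_nonneg.2 (hle t ht)) hre
  have h1 : φ (T (Polynomial.aeval T S (w - v))) t = 0 := by
    have hd := hφ (Polynomial.aeval T S (w - v)) t
    rw [show φ (Polynomial.aeval T S (w - v)) = fun _ => 0 from funext h0] at hd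
    exact hd.unique (hasDerivAt_const t 0)
  -- `X - ρ` kills `w`, so applying `(X - ρ) S` to `v` is the same as applying it to `v - w`.
  have e : Polynomial.aeval T ((X - C (ρ : ℂ)) * S) v =
      (ρ : ℂ) • Polynomial.aeval T S (w - v) - T (Polynomial.aeval T S (w - v)) := by
    have hw0 : Polynomial.aeval T ((X - C (ρ : ℂ)) * S) w = 0 := by
      rw [aeval_apply_of_map_eq_smul hTw]; simp
    rw [← sub_eq_zero, ← hw0]
    simp [Module.algebraMap_end_apply, smul_sub]
    abel
  rw [e, map_sub, map_smul, Pi.sub_apply, Pi.smul_apply, h0, h1]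
  simp

end SubdominantPole

/-! ### State-space responses and minimality -/

section Realization

open Polynomial Set

variable {n : ℕ}

open scoped Matrix.Norms.Operator in
theorem hasDerivAt_exp_smul_apply (A : Matrix (Fin n) (Fin n) ℝ) (i j : Fin n) (t : ℝ) :
    HasDerivAt (fun t : ℝ => NormedSpace.exp (t • A) i j) ((NormedSpace.exp (t • A) * A) i j) t :=
  (LinearMap.toContinuousLinearMap (Matrix.entryLinearMap ℝ ℝ i j)).hasFDerivAt.comp_hasDerivAt t
    (hasDerivAt_exp_smul_const A t)

open scoped Matrix.Norms.Operator in
-- Shows that the Markov parameters `c A^k b` determine the impulse response.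
theorem hasSum_response (A : Matrix (Fin n) (Fin n) ℝ) (b c : Fin n → ℝ) (t : ℝ) :
    HasSum (fun k : ℕ => (k.factorial : ℝ)⁻¹ * t ^ k * (c ⬝ᵥ (A ^ k *ᵥ b)))
      (c ⬝ᵥ (NormedSpace.exp (t • A) *ᵥ b)) := by
  let L : Matrix (Fin n) (Fin n) ℝ →ₗ[ℝ] ℝ :=
    { toFun := fun M => c ⬝ᵥ (M *ᵥ b)
      map_add' := fun M N => by rw [Matrix.add_mulVec, dotProduct_add]
      map_smul' := fun a M => by simp [Matrix.smul_mulVec] }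
  have e : (fun k : ℕ => (k.factorial : ℝ)⁻¹ * t ^ k * (c ⬝ᵥ (A ^ k *ᵥ b))) =
      fun k => LinearMap.toContinuousLinearMap L ((k.factorial : ℝ)⁻¹ • (t • A) ^ k) := by
    ext k
    simp [L, _root_.smul_pow, mul_assoc]
  rw [e]
  exact (NormedSpace.exp_series_hasSum_exp' (𝕂 := ℝ) (t • A)).mapL
    (LinearMap.toContinuousLinearMap L)

/-- The row `c exp(A t)`. -/
noncomputable def outputRow (A : Matrix (Fin n) (Fin n) ℝ) (c : Fin n → ℝ) (t : ℝ) : Fin n → ℝ :=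
  c ᵥ* NormedSpace.exp (t • A)

theorem hasDerivAt_outputRow (A : Matrix (Fin n) (Fin n) ℝ) (c : Fin n → ℝ) (t : ℝ) (j : Fin n) :
    HasDerivAt (fun t => outputRow A c t j) ((outputRow A c t ᵥ* A) j) t := by
  simp only [outputRow, Matrix.vecMul_vecMul]
  simp only [Matrix.vecMul, dotProduct]
  exact HasDerivAt.fun_sum fun i _ => (hasDerivAt_exp_smul_apply A i j t).const_mul (c i)

/-- The response `t ↦ c exp(A t) v` to a complex initial state `v`. -/
noncomputable def stateResponse (A : Matrix (Fin n) (Fin n) ℝ) (c : Fin n → ℝ) :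
    (Fin n → ℂ) →ₗ[ℂ] (ℝ → ℂ) where
  toFun v t := (algebraMap ℝ ℂ ∘ outputRow A c t) ⬝ᵥ v
  map_add' v w := by ext t; simp [dotProduct_add]
  map_smul' a v := by ext t; simp

/-- The state matrix as an endomorphism of the complex state space. -/
noncomputable def stateMap (A : Matrix (Fin n) (Fin n) ℝ) : Module.End ℂ (Fin n → ℂ) :=
  Matrix.toLin' (A.map (algebraMap ℝ ℂ))

theorem hasDerivAt_stateResponse (A : Matrix (Fin n) (Fin n) ℝ) (c : Fin n → ℝ) (v : Fin n → ℂ)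
    (t : ℝ) : HasDerivAt (stateResponse A c v) (stateResponse A c (stateMap A v) t) t := by
  have e : stateResponse A c (stateMap A v) t =
      ∑ j, (((outputRow A c t ᵥ* A) j : ℝ) : ℂ) * v j := by
    change (algebraMap ℝ ℂ ∘ outputRow A c t) ⬝ᵥ (stateMap A v) = _
    rw [stateMap, Matrix.toLin'_apply, Matrix.dotProduct_mulVec]
    refine Finset.sum_congr rfl fun j _ => ?_
    rw [← RingHom.map_vecMul]
    rfl
  rw [e]
  exact HasDerivAt.fun_sum (u := Finset.univ)
    fun j _ => (hasDerivAt_outputRow A c t j).ofReal_comp.mul_const (v j)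

theorem stateResponse_ofReal (A : Matrix (Fin n) (Fin n) ℝ) (b c : Fin n → ℝ) (t : ℝ) :
    stateResponse A c (algebraMap ℝ ℂ ∘ b) t =
      ((c ⬝ᵥ (NormedSpace.exp (t • A) *ᵥ b) : ℝ) : ℂ) := by
  change (algebraMap ℝ ℂ ∘ outputRow A c t) ⬝ᵥ (algebraMap ℝ ℂ ∘ b) = _
  rw [← RingHom.map_dotProduct, Matrix.dotProduct_mulVec]
  rfl

theorem stateMap_pow_ofReal (A : Matrix (Fin n) (Fin n) ℝ) (b : Fin n → ℝ) (k : ℕ) :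
    (stateMap A ^ k) (algebraMap ℝ ℂ ∘ b) = algebraMap ℝ ℂ ∘ (A ^ k *ᵥ b) := by
  induction k with
  | zero => simp
  | succ k ih =>
    rw [pow_succ', Module.End.mul_apply, ih, pow_succ', ← Matrix.mulVec_mulVec, stateMap,
      Matrix.toLin'_apply]
    ext i
    rw [← RingHom.map_mulVec]
    rfl

theorem stateResponse_pow_zero (A : Matrix (Fin n) (Fin n) ℝ) (b c : Fin n → ℝ) (k : ℕ) :
    stateResponse A c ((stateMap A ^ k) (algebraMap ℝ ℂ ∘ b)) 0 =
      ((c ⬝ᵥ (A ^ k *ᵥ b) : ℝ) : ℂ) := by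
  rw [stateMap_pow_ofReal, stateResponse_ofReal]
  simp

theorem aeval_charpoly_stateMap (A : Matrix (Fin n) (Fin n) ℝ) :
    aeval (stateMap A) (A.map (algebraMap ℝ ℂ)).charpoly = 0 := by
  have := congrArg Matrix.toLinAlgEquiv' (Matrix.aeval_self_charpoly (A.map (algebraMap ℝ ℂ)))
  rwa [← AlgEquiv.coe_toAlgHom, ← aeval_algHom_apply, map_zero] at this

/-- A minimal realization is no larger than any abstract linear system with the same Markov
parameters. -/
theorem IsMinimalRealization.le_of_markov {A : Matrix (Fin n) (Fin n) ℝ} {b c : Fin n → ℝ}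
    {g : ℝ → ℝ} (hmin : IsMinimalRealization A b c g) {V : Type*} [AddCommGroup V] [Module ℝ V]
    {m : ℕ} (B : Module.Basis (Fin m) ℝ V) (T : Module.End ℝ V) (x : V) (l : V →ₗ[ℝ] ℝ)
    (h : ∀ k, l ((T ^ k) x) = c ⬝ᵥ (A ^ k *ᵥ b)) : n ≤ m := by
  refine hmin.2 m (LinearMap.toMatrix B B T) (B.repr x) (fun i => l (B i)) ?_
  rw [IsRealization, ← hmin.1]
  have hk : ∀ k : ℕ, (fun i => l (B i)) ⬝ᵥ ((LinearMap.toMatrix B B T) ^ k *ᵥ (B.repr x)) =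
      c ⬝ᵥ (A ^ k *ᵥ b) := by
    intro k
    rw [LinearMap.toMatrix_pow, LinearMap.toMatrix_mulVec_repr, ← h k]
    conv_rhs => rw [← B.sum_repr ((T ^ k) x)]
    simp only [map_sum, map_smul, smul_eq_mul, dotProduct]
    exact Finset.sum_congr rfl fun i _ => mul_comm _ _
  unfold impulseResponse
  congr 1
  ext t
  refine (hasSum_response _ _ _ t).unique ?_
  simpa only [hk] using hasSum_response A b c t

/-- The shift on the solutions of a linear recurrence. -/
def recurrenceShift (L : LinearRecurrence ℝ) : Module.End ℝ L.solSpace where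
  toFun u := ⟨fun k => u.1 (k + 1), fun k => by
    have := u.2 (k + 1)
    simpa only [add_right_comm] using this⟩
  map_add' _ _ := rfl
  map_smul' _ _ := rfl

theorem recurrenceShift_pow_apply (L : LinearRecurrence ℝ) (k j : ℕ) (u : L.solSpace) :
    ((recurrenceShift L ^ k) u).1 j = u.1 (j + k) := by
  induction k generalizing j with
  | zero => simp
  | succ k ih =>
    rw [pow_succ', Module.End.mul_apply]
    change ((recurrenceShift L ^ k) u).1 (j + 1) = _
    rw [ih, add_right_comm, add_assoc]

/-- No differential operator of order less than the dimension of a minimal realization annihilates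
the impulse response. -/
theorem IsMinimalRealization.exists_ne_zero {A : Matrix (Fin n) (Fin n) ℝ} {b c : Fin n → ℝ}
    {g : ℝ → ℝ} (hmin : IsMinimalRealization A b c g) {R : ℂ[X]} (hR : R ≠ 0)
    (hd : R.natDegree < n) :
    ∃ t, stateResponse A c (aeval (stateMap A) R (algebraMap ℝ ℂ ∘ b)) t ≠ 0 := by
  by_contra! hz
  have hpow : ∀ k t, stateResponse A c
      ((stateMap A ^ k) (aeval (stateMap A) R (algebraMap ℝ ℂ ∘ b))) t = 0 := by
    intro k
    induction k with
    | zero => simpa using hz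
    | succ k ih =>
      intro t
      rw [pow_succ', Module.End.mul_apply]
      have hd := hasDerivAt_stateResponse A c
        ((stateMap A ^ k) (aeval (stateMap A) R (algebraMap ℝ ℂ ∘ b))) t
      rw [funext ih] at hd
      exact hd.unique (hasDerivAt_const t 0)
  set h : ℕ → ℝ := fun k => c ⬝ᵥ (A ^ k *ᵥ b) with hh
  have hlc : R.coeff R.natDegree ≠ 0 := by simpa using hR
  have hsum : ∀ k, ∑ i ∈ Finset.range (R.natDegree + 1), R.coeff i * (h (k + i) : ℂ) = 0 := by
    intro k
    rw [← hpow k 0, aeval_eq_sum_range]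
    simp only [map_sum, LinearMap.sum_apply, Finset.sum_apply, LinearMap.smul_apply, map_smul,
      Pi.smul_apply, smul_eq_mul]
    refine Finset.sum_congr rfl fun i _ => ?_
    rw [← Module.End.mul_apply, ← pow_add, stateResponse_pow_zero]
  -- The Markov parameters satisfy a recurrence with complex coefficients. As they are real, taking
  -- real parts of the coefficients preserves it, and the shift on its solution space is a
  -- realization of dimension `deg R < n`.
  let L : LinearRecurrence ℝ :=
    ⟨R.natDegree, fun i => (-(R.coeff i / R.coeff R.natDegree)).re⟩
  have hsol : L.IsSolution h := by
    intro k
    have h1 := hsum k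
    rw [Finset.sum_range_succ, Finset.sum_range] at h1
    have h2 : (h (k + R.natDegree) : ℂ) =
        ∑ i : Fin R.natDegree, -(R.coeff i / R.coeff R.natDegree) * (h (k + i) : ℂ) := by
      rw [← mul_right_inj' hlc, Finset.mul_sum]
      rw [eq_neg_of_add_eq_zero_right h1, ← Finset.sum_neg_distrib]
      refine Finset.sum_congr rfl fun i _ => ?_
      field_simp
    have h3 := congrArg Complex.re h2
    simpa only [Complex.ofReal_re, Complex.re_sum, Complex.re_mul_ofReal] using h3
  refine absurd (hmin.le_of_markov L.basis (recurrenceShift L) ⟨h, hsol⟩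
    ((LinearMap.proj 0).comp L.solSpace.subtype) fun k => ?_) (not_le.2 hd)
  change ((recurrenceShift L ^ k) ⟨h, hsol⟩).1 0 = _
  rw [recurrenceShift_pow_apply, zero_add]

end Realization

/-! ### The two dominant eigenvalues -/

section DominantPoles

open Polynomial Set

variable {n : ℕ} {A : Matrix (Fin n) (Fin n) ℝ} {b c : Fin n → ℝ} {g : ℝ → ℝ} {z w : ℂ}
  {L : List ℂ}

theorem Precedes.re_le (h : Precedes z w) : w.re ≤ z.re := by
  rcases h with h | h
  exacts [h.le, h.1.ge]

/-- A nonreal number precedes no real number with the same real part. -/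
theorem Precedes.im_eq_zero (h : Precedes z z.re) : z.im = 0 := by
  have h1 : ‖(z.re : ℂ)‖ ≤ ‖z‖ := by
    rw [Complex.norm_real]; exact Complex.abs_re_le_norm z
  rcases h with h | ⟨-, h | ⟨h, -⟩⟩
  · simp at h
  · exact absurd h (not_lt.2 h1)
  · rw [Complex.norm_real, Real.norm_eq_abs] at h
    exact Complex.abs_re_eq_norm.1 h.symm

theorem charpoly_eq_prod (A : Matrix (Fin n) (Fin n) ℝ) :
    (A.map (algebraMap ℝ ℂ)).charpoly = ((eigenvalueList A).map fun z => X - C z).prod := by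
  have h := (IsAlgClosed.splits (A.map (algebraMap ℝ ℂ)).charpoly).eq_prod_roots_of_monic
    (Matrix.charpoly_monic _)
  rw [h, ← Multiset.sort_eq (A.map (algebraMap ℝ ℂ)).charpoly.roots Precedes, Multiset.map_coe,
    Multiset.prod_coe]
  rfl

theorem pairwise_eigenvalueList (A : Matrix (Fin n) (Fin n) ℝ) :
    (eigenvalueList A).Pairwise Precedes :=
  Multiset.pairwise_sort _ _

theorem isRoot_prod_iff : (L.map fun z => X - C z).prod.IsRoot w ↔ w ∈ L := by
  induction L with
  | nil => simp
  | cons a L ih => rw [List.map_cons, List.prod_cons, root_mul, ih, root_X_sub_C, List.mem_cons, eq_comm]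

theorem prod_ne_zero (L : List ℂ) : (L.map fun z => X - C z).prod ≠ 0 := by
  induction L with
  | nil => simp
  | cons a L ih => simpa only [List.map_cons, List.prod_cons] using mul_ne_zero (X_sub_C_ne_zero a) ih

theorem natDegree_prod (L : List ℂ) : (L.map fun z => X - C z).prod.natDegree = L.length := by
  induction L with
  | nil => simp
  | cons a L ih =>
    rw [List.map_cons, List.prod_cons, natDegree_mul (X_sub_C_ne_zero a) (prod_ne_zero L), ih,
      natDegree_X_sub_C, List.length_cons, add_comm]

theorem annihilatedBy_stateMap (he : eigenvalueList A = z :: L) (v : Fin n → ℂ) :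
    AnnihilatedBy (stateMap A) ((X - C z) * (L.map fun z => X - C z).prod) z.re v := by
  have e : (X - C z) * (L.map fun z => X - C z).prod = ((z :: L).map fun z => X - C z).prod := by
    simp
  refine ⟨e ▸ prod_ne_zero _, ?_, fun x hx => ?_⟩
  · rw [e, ← he, ← charpoly_eq_prod, aeval_charpoly_stateMap, LinearMap.zero_apply]
  · rw [e, isRoot_prod_iff] at hx
    have hp := pairwise_eigenvalueList A
    rw [he, List.pairwise_cons] at hp
    rcases List.mem_cons.1 hx with rfl | hx
    exacts [le_rfl, (hp.1 x hx).re_le]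

theorem continuous_response (A : Matrix (Fin n) (Fin n) ℝ) (b c : Fin n → ℝ) :
    Continuous fun t : ℝ => c ⬝ᵥ (NormedSpace.exp (t • A) *ᵥ b) := by
  have e : (fun t : ℝ => c ⬝ᵥ (NormedSpace.exp (t • A) *ᵥ b)) =
      fun t => (stateResponse A c (algebraMap ℝ ℂ ∘ b) t).re := by
    ext t
    rw [stateResponse_ofReal, Complex.ofReal_re]
  rw [e]
  exact Complex.continuous_re.comp
    (continuous_iff_continuousAt.2 fun t => (hasDerivAt_stateResponse A c _ t).continuousAt)

theorem im_dominant_eq_zero (hg : IsStronglyUnimodal g) (hmin : IsMinimalRealization A b c g)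
    (he : eigenvalueList A = z :: L) : z.im = 0 := by
  have hg' : IsStronglyUnimodal (impulseResponse A b c) := hmin.1 ▸ hg
  have hcont := continuous_response A b c
  have hp := pairwise_eigenvalueList A
  have hlen := length_eigenvalueList A
  rw [he] at hp hlen
  by_contra him
  obtain ⟨t, ht⟩ := hmin.exists_ne_zero (prod_ne_zero L) (by
    rw [natDegree_prod, ← hlen]; simp)
  refine ht ((annihilatedBy_stateMap he _).eq_zero_of_nonneg (hasDerivAt_stateResponse A c)
    (fun t _ => stateResponse_ofReal A b c t) (fun t ht => hg'.nonneg hcont ht) ?_ t)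
  intro h0
  -- The real point of the critical line could only be an eigenvalue listed after `z`, which the
  -- tie-breaking by modulus excludes for nonreal `z`.
  have h1 : (z.re : ℂ) ∈ z :: L := by
    rw [← isRoot_prod_iff]
    simpa using h0
  rcases List.mem_cons.1 h1 with h1 | h1
  · rw [← h1] at him
    simp at him
  · exact him ((List.pairwise_cons.1 hp).1 _ h1).im_eq_zero

theorem im_subdominant_eq_zero (hg : IsStronglyUnimodal g) (hmin : IsMinimalRealization A b c g)
    (he : eigenvalueList A = z :: w :: L) : w.im = 0 := by
  have hz := im_dominant_eq_zero hg hmin he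
  have hzre : (z.re : ℂ) = z := Complex.ext (by simp) (by simp [hz])
  have hg' : IsStronglyUnimodal (impulseResponse A b c) := hmin.1 ▸ hg
  have hcont := continuous_response A b c
  have hp := pairwise_eigenvalueList A
  have hlen := length_eigenvalueList A
  rw [he] at hp hlen
  rw [List.pairwise_cons, List.pairwise_cons] at hp
  have hroot : ∀ x, ((X - C w) * (L.map fun z => X - C z).prod).IsRoot x ↔ x ∈ w :: L := fun x => by
    rw [← isRoot_prod_iff, List.map_cons, List.prod_cons]
  by_contra him
  obtain ⟨t, ht⟩ := hmin.exists_ne_zero (prod_ne_zero (z :: L)) (by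
    rw [natDegree_prod, ← hlen]; simp)
  have hne := hmin.exists_ne_zero (prod_ne_zero (w :: L)) (by
    rw [natDegree_prod, ← hlen]; simp)
  have hann := annihilatedBy_stateMap he (algebraMap ℝ ℂ ∘ b)
  rw [List.map_cons, List.prod_cons] at hann hne ht
  rw [← hzre] at hann ht
  rw [Complex.ofReal_re] at hann
  refine ht (hann.eq_zero_of_logConcave (hasDerivAt_stateResponse A c)
    (stateResponse_ofReal A b c) (fun t ht => hg'.nonneg hcont ht)
    (fun x s d hx hs hd => hg'.mul_le_mul hcont hx hs hd) hne ?_ ?_ ?_ t)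
  -- If the dominant pole is not simple, the ordering puts a second copy of it in second place, so
  -- `w = z` is real.
  · intro h0
    rw [hzre] at h0
    rcases List.mem_cons.1 ((hroot z).1 h0) with h1 | h1
    · exact him (h1 ▸ hz)
    · exact him (antisymm (r := Precedes) (hp.1 w (by simp)) (hp.2.1 z h1) ▸ hz)
  · intro x hx
    rcases List.mem_cons.1 ((hroot x).1 hx) with rfl | h1
    exacts [le_rfl, (hp.2.1 x h1).re_le]
  · intro h0
    rcases List.mem_cons.1 ((hroot _).1 h0) with h1 | h1
    · rw [← h1] at him
      simp at him
    · exact him (hp.2.1 _ h1).im_eq_zero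

theorem im_sum_eigenvalueList (A : Matrix (Fin n) (Fin n) ℝ) : (eigenvalueList A).sum.im = 0 := by
  have h : (eigenvalueList A).sum = (A.map (algebraMap ℝ ℂ)).trace := by
    rw [Matrix.trace_eq_sum_roots_charpoly, ← Multiset.sort_eq
      (A.map (algebraMap ℝ ℂ)).charpoly.roots Precedes, Multiset.sum_coe]
    rfl
  rw [h]
  simp [Matrix.trace]

theorem getElem?_eigenvalueList (A : Matrix (Fin n) (Fin n) ℝ) (i : Fin n) :
    (eigenvalueList A)[(i : ℕ)]? = some (eigenvalue A i) := by
  rw [List.getElem?_eq_getElem (by rw [length_eigenvalueList]; exact i.2)]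
  rfl

end DominantPoles

end UnimodalLTI

open UnimodalLTI in
theorem theorem2 {n : ℕ} (A : Matrix (Fin n) (Fin n) ℝ) (b c : Fin n → ℝ) (g : ℝ → ℝ)
    (hg : IsStronglyUnimodal g) (hmin : IsMinimalRealization A b c g) :
    (∀ i : Fin n, (i : ℕ) < 2 → (eigenvalue A i).im = 0) ∧
      (n = 3 → ∀ i : Fin n, (eigenvalue A i).im = 0) := by
  have h2 : ∀ i : Fin n, (i : ℕ) < 2 → (eigenvalue A i).im = 0 := by
    intro i hi
    have hget := getElem?_eigenvalueList A i
    rcases he : eigenvalueList A with _ | ⟨z, _ | ⟨w, L⟩⟩ <;> rw [he] at hget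
    · simp at hget
    · have h0 : (i : ℕ) = 0 := by by_contra h; simp [h] at hget
      simp only [h0, List.getElem?_cons_zero, Option.some.injEq] at hget
      exact hget ▸ im_dominant_eq_zero hg hmin he
    · obtain h0 | h1 : (i : ℕ) = 0 ∨ (i : ℕ) = 1 := by omega
      · simp only [h0, List.getElem?_cons_zero, Option.some.injEq] at hget
        exact hget ▸ im_dominant_eq_zero hg hmin he
      · simp only [h1, List.getElem?_cons_succ, List.getElem?_cons_zero, Option.some.injEq] at hget
        exact hget ▸ im_subdominant_eq_zero hg hmin he
  refine ⟨h2, ?_⟩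
  rintro rfl i
  by_cases hi : (i : ℕ) < 2
  · exact h2 i hi
  have hlen := length_eigenvalueList A
  -- The eigenvalues sum to the real trace, so reality of two of the three forces that of the third.
  have hsum := im_sum_eigenvalueList A
  have hget := getElem?_eigenvalueList A i
  obtain ⟨z, w, v, he⟩ := List.length_eq_three.1 hlen
  have hz := im_dominant_eq_zero hg hmin he
  have hw := im_subdominant_eq_zero hg hmin he
  have hi2 : (i : ℕ) = 2 := by omega
  rw [he, hi2] at hget
  simp only [List.getElem?_cons_succ, List.getElem?_cons_zero, Option.some.injEq] at hget
  rw [he] at hsum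
  simpa [hz, hw, hget] using hsum
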